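/- Let $\mathcal X$ be a finite set and $W=(W(x|x'))_{x,x'\in\mathcal X}$ a transition matrix ($W(x|x')\ge 0$, $\sum_x W(x|x')=1$) that is irreducible and aperiodic (ergodic). Let $g:\mathcal X^2\to\mathbb R$ be such that no $f:\mathcal X\to\mathbb R$ and $c\in\mathbb R$ satisfy $g(x,x')=f(x)-f(x')+c$ for all $(x,x')$ with $W(x|x')>0$. For $\theta\in\mathbb R$ let $\overline W_\theta(x|x')=W(x|x')e^{\theta g(x,x')}$, let $\lambda_\theta$ be its Perron--Frobenius eigenvalue, $\overline P^3_\theta$ the Perron--Frobenius eigenvector of $\overline W_\theta^{T}$, $\phi(\theta)=\log\lambda_\theta$, $\eta(\theta)=\phi'(\theta)$, and let $$W_\theta(x|x')=\lambda_\theta^{-1}\,\overline P^3_\theta(x)\,\overline W_\theta(x|x')\,\overline P^3_\theta(x')^{-1}$$ be the exponential family of transition matrices generated by $W$ with generator $g$. Let $P_\theta$ ($\theta\in\mathbb R$) be arbitrary probability distributions on $\mathcal X$ that depend on $\theta$ in a continuously differentiable (in particular, possibly smooth) way, and let $h:\mathcal X\to\mathbb R$ be any function. Let $X^{n+1}=(X_{n+1},\dots,X_1)$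 have the law $W_\theta(x_{n+1}|x_n)\cdots W_\theta(x_2|x_1)P_\theta(x_1)$, with expectation $\mathsf E_\theta$ and variance $\mathsf V_\theta$, and put $g^n=\sum_{k=1}^n g(X_{k+1},X_k)$ and $\tilde g^n=g^n+h(X_1)$. Let $J^n_\theta$ be the Fisher information at $\theta$ of this family of laws of $X^{n+1}$, and $\tilde J^n_\theta$ the Fisher information at $\eta(\theta)$ of the same family parametrized by $\eta$ (outcomes of probability zero contribute zero). Then $\phi$ is twice continuously differentiable with $\phi''>0$, and for every $\theta\in\mathbb R$: 1. $\displaystyle\lim_{n\to\infty}\mathsf E_\theta\Big[\frac{\tilde g^n}{n}\Big]=\eta(\theta)$ and $$\lim_{n\to\infty} n\,\mathsf E_\theta\Big[\Big(\frac{\tilde g^n}{n}-\eta(\theta)\Big)^2\Big]=\lim_{n\to\infty}\mathsf V_\theta\Big[\frac{\tilde g^n}{\sqrt n}\Big]=\lim_{n\to\infty}\mathsf V_\theta\Big[\frac{g^n}{\sqrt n}\Big]=\phi''(\theta).$$ 2. $\displaystyle\lim_{n\to\infty}\frac{J^n_\theta}{n}=\phi''(\theta)$ and $\displaystyle\lim_{n\to\infty}\frac{\tilde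 J^n_\theta}{n}=\phi''(\theta)^{-1}$. 3. The estimator $\tilde g^n/n$ of $\eta$ is asymptotically efficient: the Cramér--Rao bound satisfies $(\tilde J^n_\theta)^{-1}=\frac{\phi''(\theta)}{n}+o(\frac1n)$, and it is attained at order $\frac1n$, that is, $\mathsf E_\theta\big[(\tilde g^n/n-\eta(\theta))^2\big]=(\tilde J^n_\theta)^{-1}+o(\frac1n)$. -/

import Mathlib

open Filter Topology Asymptotics

namespace MarkovExp

noncomputable section

/-- `W x x'` is the probability `W(x|x')` of moving from `x'` to `x`. -/
def IsTransitionMatrix {X : Type*} [Fintype X] (W : Matrix X X ℝ) : Prop :=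
  (∀ x x', 0 ≤ W x x') ∧ ∀ x', ∑ x, W x x' = 1

/-- Irreducible and aperiodic: no state `x'` and no period `d ≥ 2` are such that the
`n`-step return probability to `x'` vanishes unless `d` divides `n`. -/
def IsErgodic {X : Type*} [Fintype X] [DecidableEq X] (W : Matrix X X ℝ) : Prop :=
  W.IsIrreducible ∧
    ¬ ∃ (x' : X) (d : ℕ), 2 ≤ d ∧ ∀ n : ℕ, ¬ d ∣ n → (W ^ n) x' x' = 0

/-- No `f` and `c` satisfy `g(x,x') = f(x) - f(x') + c` on the support of `W`. -/
def IsGenerator {X : Type*} (W : Matrix X X ℝ) (g : X → X → ℝ) : Prop :=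
  ¬ ∃ (f : X → ℝ) (c : ℝ), ∀ x x', 0 < W x x' → g x x' = f x - f x' + c

/-- The Perron-Frobenius eigenvalue of a nonnegative matrix: its spectral radius. -/
def perronRoot {X : Type*} [Fintype X] [DecidableEq X] (A : Matrix X X ℝ) : ℝ :=
  (spectralRadius ℂ (A.map (fun r : ℝ => (r : ℂ)))).toReal

/-- `v` is an entrywise positive eigenvector for the Perron-Frobenius eigenvalue,
with entries summing to one. -/
def IsPerronVector {X : Type*} [Fintype X] [DecidableEq X]
    (A : Matrix X X ℝ) (v : X → ℝ) : Prop :=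
  (∀ x, 0 < v x) ∧ ∑ x, v x = 1 ∧ A.mulVec v = perronRoot A • v

/-- The Perron-Frobenius eigenvector; it exists and is unique when `A` is irreducible. -/
def perronVector {X : Type*} [Fintype X] [DecidableEq X] (A : Matrix X X ℝ) : X → ℝ :=
  Classical.epsilon (IsPerronVector A)

/-- The tilted matrix `W(x|x') exp (θ g(x,x'))`. -/
def tilted {X : Type*} (W : Matrix X X ℝ) (g : X → X → ℝ) (θ : ℝ) : Matrix X X ℝ :=
  Matrix.of fun x x' => W x x' * Real.exp (θ * g x x')

/-- The potential function `φ(θ)`. -/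
def potential {X : Type*} [Fintype X] [DecidableEq X]
    (W : Matrix X X ℝ) (g : X → X → ℝ) (θ : ℝ) : ℝ :=
  Real.log (perronRoot (tilted W g θ))

/-- The exponential family `W_θ` generated by `W` with generator `g`. -/
def expFamily {X : Type*} [Fintype X] [DecidableEq X]
    (W : Matrix X X ℝ) (g : X → X → ℝ) (θ : ℝ) : Matrix X X ℝ :=
  Matrix.of fun x x' =>
    (perronRoot (tilted W g θ))⁻¹ * perronVector (tilted W g θ).transpose x *
      tilted W g θ x x' * (perronVector (tilted W g θ).transpose x')⁻¹

/-- The expectation parameter `η(θ) = φ'(θ)`. -/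
def expectationParam {X : Type*} [Fintype X] [DecidableEq X]
    (W : Matrix X X ℝ) (g : X → X → ℝ) (θ : ℝ) : ℝ :=
  deriv (potential W g) θ

/-- The natural parameter `θ(η)` as a function of the expectation parameter. -/
def naturalParam {X : Type*} [Fintype X] [DecidableEq X]
    (W : Matrix X X ℝ) (g : X → X → ℝ) : ℝ → ℝ :=
  Function.invFun (expectationParam W g)

/-- The law of a Markov chain with `n` transitions, initial law `P` and transition matrix `V`;
`ω 0` is the first observation `X₁` and `ω n` the last one, `Xₙ₊₁`. -/
def pathLaw {X : Type*} (V : Matrix X X ℝ) (P : X → ℝ) (n : ℕ) (ω : Fin (n + 1) → X) : ℝ :=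
  P (ω 0) * ∏ i : Fin n, V (ω i.succ) (ω i.castSucc)

/-- `gⁿ(Xⁿ⁺¹) = ∑ₖ g(Xₖ₊₁, Xₖ)`. -/
def pathSum {X : Type*} (g : X → X → ℝ) (n : ℕ) (ω : Fin (n + 1) → X) : ℝ :=
  ∑ i : Fin n, g (ω i.succ) (ω i.castSucc)

/-- Expectation of `f` under the probability mass function `p`. -/
def expect {Ω : Type*} [Fintype Ω] (p f : Ω → ℝ) : ℝ := ∑ ω, p ω * f ω

/-- Variance of `f` under the probability mass function `p`. -/
def pvar {Ω : Type*} [Fintype Ω] (p f : Ω → ℝ) : ℝ :=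
  expect p fun ω => (f ω - expect p f) ^ 2

/-- Fisher information at `t` of a one-parameter family of probability mass functions.
Points of zero probability contribute zero. -/
def fisherInfo {Ω : Type*} [Fintype Ω] (p : ℝ → Ω → ℝ) (t : ℝ) : ℝ :=
  expect (p t) fun ω => (deriv (fun s => Real.log (p s ω)) t) ^ 2

/-- The law of `Xⁿ⁺¹` at parameter `θ`. -/
def modelLaw {X : Type*} [Fintype X] [DecidableEq X] (W : Matrix X X ℝ) (g : X → X → ℝ)
    (P : ℝ → X → ℝ) (n : ℕ) (θ : ℝ) : (Fin (n + 1) → X) → ℝ :=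
  pathLaw (expFamily W g θ) (P θ) n

/-- The corrected sum `gⁿ(Xⁿ⁺¹) + h(X₁)`. -/
def correctedSum {X : Type*} (g : X → X → ℝ) (h : X → ℝ) (n : ℕ)
    (ω : Fin (n + 1) → X) : ℝ :=
  pathSum g n ω + h (ω 0)

/-- Mean square error, as an estimator of `η(θ)`, of `(gⁿ(Xⁿ⁺¹) + h(X₁)) / n`. -/
def mse {X : Type*} [Fintype X] [DecidableEq X] (W : Matrix X X ℝ) (g : X → X → ℝ)
    (P : ℝ → X → ℝ) (h : X → ℝ) (n : ℕ) (θ : ℝ) : ℝ :=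
  expect (modelLaw W g P n θ) fun ω =>
    (correctedSum g h n ω / n - expectationParam W g θ) ^ 2

/-- Fisher information of `Xⁿ⁺¹` for the natural parameter, at `θ`. -/
def fisherNatural {X : Type*} [Fintype X] [DecidableEq X] (W : Matrix X X ℝ)
    (g : X → X → ℝ) (P : ℝ → X → ℝ) (n : ℕ) (θ : ℝ) : ℝ :=
  fisherInfo (modelLaw W g P n) θ

/-- Fisher information of `Xⁿ⁺¹` for the expectation parameter: that of the family
reparametrized by `η`, at `η(θ)`. -/
def fisherExpectation {X : Type*} [Fintype X] [DecidableEq X] (W : Matrix X X ℝ)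
    (g : X → X → ℝ) (P : ℝ → X → ℝ) (n : ℕ) (θ : ℝ) : ℝ :=
  fisherInfo (fun η => modelLaw W g P n (naturalParam W g η)) (expectationParam W g θ)

end

end MarkovExp

/-! Let `l_s` be the positive left Perron vector of the tilted matrix. Then `W_s(x|y) = W(x|y) exp(s
g(x,y) - φ(s) + log l_s(x) - log l_s(y))`, and along a path the `log l_s` terms telescope
(`pathLaw_expFamily`). With the initial law frozen, the score is therefore `gⁿ - n η(s)` plus a
boundary term depending only on the two end states, hence bounded uniformly in `n`.

Differentiating twice the fact that the total mass is one (`score_identities`) shows that this score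
has mean zero and second moment `n φ''` up to a bounded error (`expect_pathScore`). No mixing
estimate is needed. The centred estimator, its mean square error and the score of the full model all
differ from this score by bounded terms, and by Cauchy-Schwarz such terms do not affect the second
moment divided by `n` (`tendsto_expect_add_sq`).

Smoothness of `φ` comes from the implicit function theorem applied to the eigenvector equation
(`contDiff_perronVector`). Positivity of `φ''` comes from the same identity for one step, averaged
over a stationary measure: `φ''` is proportional to the mean squared one-step score, which vanishes
only if `g` is of the excluded form. Finally `η' = φ'' > 0` gives the change of parameter, which
divides the Fisher information by `φ''²`. -/

namespace MarkovExp

noncomputable section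

/-! ### Perron-Frobenius theory of irreducible matrices -/

section Perron

variable {X : Type*} [Fintype X] [DecidableEq X]

lemma pow_mulVec_of_eigen {A : Matrix X X ℝ} {v : X → ℝ} {μ : ℝ}
    (h : A.mulVec v = μ • v) (k : ℕ) : (A ^ k).mulVec v = μ ^ k • v := by
  induction k with
  | zero => simp
  | succ k ih => rw [pow_succ, ← Matrix.mulVec_mulVec, h, Matrix.mulVec_smul, ih, smul_smul,
      pow_succ, mul_comm]

/-- A nonzero nonnegative eigenvector of an irreducible matrix is positive. -/
lemma eigenvector_pos {A : Matrix X X ℝ} (hA : A.IsIrreducible) {v : X → ℝ} {μ : ℝ}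
    (hv : ∀ x, 0 ≤ v x) (hv0 : v ≠ 0) (h : A.mulVec v = μ • v) (x : X) : 0 < v x := by
  obtain ⟨y, hy⟩ := Function.ne_iff.1 hv0
  have hy : 0 < v y := lt_of_le_of_ne (hv y) (Ne.symm hy)
  obtain ⟨k, -, hk⟩ := (Matrix.isIrreducible_iff_exists_pow_pos hA.nonneg).1 hA x y
  have h1 := congrFun (pow_mulVec_of_eigen h k) x
  have h2 : (A ^ k) x y * v y ≤ (A ^ k).mulVec v x :=
    Finset.single_le_sum (f := fun z => (A ^ k) x z * v z)
      (fun z _ => mul_nonneg (Matrix.pow_apply_nonneg hA.nonneg k x z) (hv z)) (Finset.mem_univ y)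
  refine lt_of_le_of_ne (hv x) fun h0 => ?_
  rw [h1, Pi.smul_apply, ← h0, smul_zero] at h2
  exact absurd h2 (not_le.2 (mul_pos hk hy))

/-- A positive matrix commuting with a given irreducible one. -/
lemma exists_pos_commute {A : Matrix X X ℝ} (hA : A.IsIrreducible) :
    ∃ B : Matrix X X ℝ, (∀ x y, 0 < B x y) ∧ A * B = B * A := by
  choose k hk0 hk using (Matrix.isIrreducible_iff_exists_pow_pos hA.nonneg).1 hA
  refine ⟨∑ p : X × X, A ^ k p.1 p.2, fun x y => ?_, ?_⟩
  · rw [Matrix.sum_apply]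
    exact (hk x y).trans_le (Finset.single_le_sum (f := fun p : X × X => (A ^ k p.1 p.2) x y)
      (fun p _ => Matrix.pow_apply_nonneg hA.nonneg _ x y) (Finset.mem_univ (x, y)))
  · rw [Finset.mul_sum, Finset.sum_mul]
    exact Finset.sum_congr rfl fun p _ => (pow_mul_comm' A _).symm

omit [DecidableEq X] in
lemma mulVec_pos {B : Matrix X X ℝ} (hB : ∀ x y, 0 < B x y) {w : X → ℝ}
    (hw : ∀ x, 0 ≤ w x) (hw0 : w ≠ 0) (x : X) : 0 < B.mulVec w x := by
  obtain ⟨y, hy⟩ := Function.ne_iff.1 hw0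
  have hy : 0 < w y := lt_of_le_of_ne (hw y) (Ne.symm hy)
  exact (mul_pos (hB x y) hy).trans_le (Finset.single_le_sum (f := fun z => B x z * w z)
    (fun z _ => mul_nonneg (hB x z).le (hw z)) (Finset.mem_univ y))

/-- Existence of the Perron-Frobenius eigenvector, by maximizing the Collatz-Wielandt bound. -/
lemma exists_pos_eigenvector [Nonempty X] {A : Matrix X X ℝ} (hA : A.IsIrreducible) :
    ∃ (v : X → ℝ) (μ : ℝ), (∀ x, 0 < v x) ∧ ∑ x, v x = 1 ∧ A.mulVec v = μ • v := by
  set C : ℝ := ∑ x, ∑ y, A x y with hC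
  have hbound : ∀ v ∈ stdSimplex ℝ X, ∑ x, A.mulVec v x ≤ C := by
    intro v hv
    refine Finset.sum_le_sum fun x _ => Finset.sum_le_sum fun y _ => ?_
    exact mul_le_of_le_one_right (hA.nonneg x y) (mem_Icc_of_mem_stdSimplex hv y).2
  have hle : ∀ v ∈ stdSimplex ℝ X, ∀ t : ℝ, (∀ x, t * v x ≤ A.mulVec v x) → t ≤ C := by
    intro v hv t ht
    calc t = ∑ x, t * v x := by rw [← Finset.mul_sum, hv.2, mul_one]
      _ ≤ ∑ x, A.mulVec v x := Finset.sum_le_sum fun x _ => ht x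
      _ ≤ C := hbound v hv
  -- By `hle` the cap `C` excludes no admissible pair with `t ≥ 0`; it only makes the set compact.
  let S : Set (ℝ × (X → ℝ)) :=
    (Set.Icc 0 C ×ˢ stdSimplex ℝ X) ∩ {p | ∀ x, p.1 * p.2 x ≤ A.mulVec p.2 x}
  have hS : IsCompact S := by
    refine (isCompact_Icc.prod (isCompact_stdSimplex ℝ X)).inter_right ?_
    simp only [Set.ofPred_forall]
    refine isClosed_iInter fun x => isClosed_le (by fun_prop) ?_
    simp only [Matrix.mulVec, dotProduct]
    fun_prop
  have hSne : S.Nonempty := by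
    obtain ⟨x⟩ := ‹Nonempty X›
    have h1 : (Pi.single x 1 : X → ℝ) ∈ stdSimplex ℝ X := single_mem_stdSimplex ℝ x
    have h2 : ∀ y, 0 * (Pi.single x 1 : X → ℝ) y ≤ A.mulVec (Pi.single x 1) y := by
      intro y
      simpa using hA.nonneg y x
    exact ⟨(0, Pi.single x 1), ⟨⟨⟨le_rfl, hle _ h1 _ h2⟩, h1⟩, h2⟩⟩
  obtain ⟨⟨t, v⟩, ⟨⟨⟨ht0, -⟩, hv⟩, htv⟩, hmax⟩ :=
    hS.exists_isMaxOn hSne (continuous_fst.continuousOn)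
  simp only [Set.mem_ofPred_eq] at ht0 hv htv
  have hv0 : v ≠ 0 := by
    rintro rfl
    simpa using hv.2
  have heig : A.mulVec v = t • v := by
    by_contra hne
    obtain ⟨B, hB, hAB⟩ := exists_pos_commute hA
    have hw : ∀ x, 0 ≤ (A.mulVec v - t • v) x := fun x => by
      simpa using htv x
    have hBw := mulVec_pos hB hw (sub_ne_zero.2 hne)
    have hu := mulVec_pos hB hv.1 hv0
    set u := B.mulVec v with hudef
    have hBw' : ∀ x, B.mulVec (A.mulVec v - t • v) x = A.mulVec u x - t * u x := by
      intro x
      rw [Matrix.mulVec_sub, Matrix.mulVec_smul, Matrix.mulVec_mulVec, ← hAB,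
        ← Matrix.mulVec_mulVec]
      simp [hudef]
    obtain ⟨x₀, hx₀⟩ := Finite.exists_min fun x => (A.mulVec u x - t * u x) / u x
    set ε := (A.mulVec u x₀ - t * u x₀) / u x₀ with hε
    have hεpos : 0 < ε := div_pos (by rw [← hBw']; exact hBw x₀) (hu x₀)
    have hs : 0 < ∑ x, u x := Finset.sum_pos (fun x _ => hu x) Finset.univ_nonempty
    have h1 : (∑ x, u x)⁻¹ • u ∈ stdSimplex ℝ X := by
      refine ⟨fun x => mul_nonneg (inv_nonneg.2 hs.le) (hu x).le, ?_⟩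
      simp only [Pi.smul_apply, smul_eq_mul, ← Finset.mul_sum]
      exact inv_mul_cancel₀ hs.ne'
    have h2 : ∀ x, (t + ε) * ((∑ x, u x)⁻¹ • u) x ≤ A.mulVec ((∑ x, u x)⁻¹ • u) x := by
      intro x
      have := (le_div_iff₀ (hu x)).1 (hx₀ x)
      rw [Matrix.mulVec_smul, Pi.smul_apply, Pi.smul_apply, smul_eq_mul, smul_eq_mul,
        mul_left_comm]
      exact mul_le_mul_of_nonneg_left (by linarith) (inv_nonneg.2 hs.le)
    have := hmax (a := (t + ε, (∑ x, u x)⁻¹ • u))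
      ⟨⟨⟨by simpa using by linarith, hle _ h1 _ h2⟩, h1⟩, h2⟩
    simp only [Set.mem_ofPred_eq] at this
    linarith
  exact ⟨v, t, eigenvector_pos hA hv.1 hv0 heig, hv.2, heig⟩

omit [DecidableEq X] in
lemma eigenvalue_nonneg [Nonempty X] {A : Matrix X X ℝ} (hA : ∀ x y, 0 ≤ A x y) {v : X → ℝ}
    {μ : ℝ} (hv : ∀ x, 0 < v x) (h : A.mulVec v = μ • v) : 0 ≤ μ := by
  obtain ⟨x⟩ := ‹Nonempty X›
  have h1 : 0 ≤ A.mulVec v x := Finset.sum_nonneg fun y _ => mul_nonneg (hA x y) (hv y).le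
  rw [h, Pi.smul_apply, smul_eq_mul] at h1
  exact nonneg_of_mul_nonneg_left h1 (hv x)

/-- The eigenvalue of a positive eigenvector of a nonnegative matrix is the spectral radius. -/
lemma perronRoot_eq [Nonempty X] {A : Matrix X X ℝ} (hA : ∀ x y, 0 ≤ A x y) {v : X → ℝ}
    {μ : ℝ} (hv : ∀ x, 0 < v x) (h : A.mulVec v = μ • v) : perronRoot A = μ := by
  have hμ := eigenvalue_nonneg hA hv h
  have key : spectralRadius ℂ (A.map (fun r : ℝ => (r : ℂ))) = ENNReal.ofReal μ := by
    apply le_antisymm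
    · refine iSup₂_le fun z hz => ?_
      rw [← Matrix.spectrum_toLin', ← Module.End.hasEigenvalue_iff_mem_spectrum] at hz
      obtain ⟨w, hw⟩ := hz.exists_hasEigenvector
      have hw1 : ∀ x, ∑ y, (A x y : ℂ) * w y = z * w x := fun x => by
        simpa [Matrix.mulVec, dotProduct] using congrFun hw.apply_eq_smul x
      -- In the sup norm weighted by `v` the matrix has norm at most `μ`; the eigenvalue equation is
      -- read at a state attaining this norm of `w`.
      obtain ⟨x₀, hx₀⟩ := Finite.exists_max fun x => ‖w x‖ / v x
      set c := ‖w x₀‖ / v x₀ with hc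
      have hwc : ∀ x, ‖w x‖ ≤ c * v x := fun x => (div_le_iff₀ (hv x)).1 (hx₀ x)
      have hcpos : 0 < c := by
        obtain ⟨y, hy⟩ := Function.ne_iff.1 hw.2
        exact (div_pos (norm_pos_iff.2 hy) (hv y)).trans_le (hx₀ y)
      have hw0 : ‖w x₀‖ = c * v x₀ := by rw [hc, div_mul_cancel₀ _ (hv x₀).ne']
      have h3 : ‖z‖ * (c * v x₀) ≤ μ * (c * v x₀) := by
        calc ‖z‖ * (c * v x₀) = ‖∑ y, (A x₀ y : ℂ) * w y‖ := by rw [hw1, norm_mul, hw0]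
          _ ≤ ∑ y, A x₀ y * (c * v y) := by
              refine (norm_sum_le _ _).trans (Finset.sum_le_sum fun y _ => ?_)
              rw [norm_mul, Complex.norm_real, Real.norm_of_nonneg (hA _ _)]
              exact mul_le_mul_of_nonneg_left (hwc y) (hA _ _)
          _ = c * A.mulVec v x₀ := by
              simp only [Matrix.mulVec, dotProduct, Finset.mul_sum]
              exact Finset.sum_congr rfl fun y _ => by ring
          _ = μ * (c * v x₀) := by rw [h, Pi.smul_apply, smul_eq_mul]; ring
      have h4 : ‖z‖ ≤ μ := le_of_mul_le_mul_right h3 (mul_pos hcpos (hv x₀))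
      change ‖z‖ₑ ≤ _
      rw [← ofReal_norm]
      exact ENNReal.ofReal_le_ofReal h4
    · have hz : (μ : ℂ) ∈ spectrum ℂ (A.map (fun r : ℝ => (r : ℂ))) := by
        rw [← Matrix.spectrum_toLin', ← Module.End.hasEigenvalue_iff_mem_spectrum]
        refine Module.End.hasEigenvalue_of_hasEigenvector (x := fun x => (v x : ℂ)) ⟨?_, ?_⟩
        · rw [Module.End.mem_eigenspace_iff]
          ext x
          have := congrArg (fun r : ℝ => (r : ℂ)) (congrFun h x)
          simpa [Matrix.mulVec, dotProduct] using this
        · obtain ⟨x⟩ := ‹Nonempty X›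
          exact fun h0 => (hv x).ne' (by simpa using congrFun h0 x)
      refine le_trans (le_of_eq ?_)
        (le_iSup₂ (f := fun (k : ℂ) (_ : k ∈ spectrum ℂ _) => (‖k‖₊ : ENNReal)) (μ : ℂ) hz)
      change _ = ‖(μ : ℂ)‖ₑ
      rw [← ofReal_norm, Complex.norm_real, Real.norm_of_nonneg hμ]
  rw [perronRoot, key, ENNReal.toReal_ofReal hμ]

lemma isPerronVector_perronVector [Nonempty X] {A : Matrix X X ℝ} (hA : A.IsIrreducible) :
    IsPerronVector A (perronVector A) := by
  obtain ⟨v, μ, hv, hs, h⟩ := exists_pos_eigenvector hA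
  exact Classical.epsilon_spec (p := IsPerronVector A)
    ⟨v, hv, hs, by rw [perronRoot_eq hA.nonneg hv h, h]⟩

/-- Subtracting from `w` the largest multiple of `v` that keeps it nonnegative leaves a nonnegative
eigenvector with a zero entry, which irreducibility forces to be zero. -/
lemma pos_eigenvector_unique [Nonempty X] {A : Matrix X X ℝ} (hA : A.IsIrreducible)
    {v w : X → ℝ} {μ ν : ℝ} (hv : ∀ x, 0 < v x) (hw : ∀ x, 0 < w x)
    (hAv : A.mulVec v = μ • v) (hAw : A.mulVec w = ν • w) : ∃ c : ℝ, w = c • v := by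
  obtain rfl : μ = ν := (perronRoot_eq hA.nonneg hv hAv).symm.trans (perronRoot_eq hA.nonneg hw hAw)
  obtain ⟨x₀, hx₀⟩ := Finite.exists_min fun x => w x / v x
  refine ⟨w x₀ / v x₀, ?_⟩
  by_contra hne
  have h1 : ∀ x, 0 ≤ (w - (w x₀ / v x₀) • v) x := fun x => by
    simpa using (le_div_iff₀ (hv x)).1 (hx₀ x)
  have h2 : A.mulVec (w - (w x₀ / v x₀) • v) = μ • (w - (w x₀ / v x₀) • v) := by
    rw [Matrix.mulVec_sub, Matrix.mulVec_smul, hAv, hAw, smul_sub, smul_comm]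
  have h3 := eigenvector_pos hA h1 (sub_ne_zero.2 hne) h2 x₀
  simp [div_mul_cancel₀ _ (hv x₀).ne'] at h3

lemma perronVector_eq [Nonempty X] {A : Matrix X X ℝ} (hA : A.IsIrreducible)
    {w : X → ℝ} {ν : ℝ} (hw : ∀ x, 0 < w x) (hs : ∑ x, w x = 1) (hAw : A.mulVec w = ν • w) :
    perronVector A = w := by
  obtain ⟨h1, h2, h3⟩ := isPerronVector_perronVector hA
  obtain ⟨c, hc⟩ := pos_eigenvector_unique hA h1 hw h3 hAw
  have : c = 1 := by
    rw [hc] at hs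
    simpa [← Finset.mul_sum, h2] using hs
  rw [hc, this, one_smul]

lemma perronRoot_transpose [Nonempty X] {A : Matrix X X ℝ} (hA : A.IsIrreducible) :
    perronRoot A.transpose = perronRoot A := by
  obtain ⟨h1, -, h3⟩ := isPerronVector_perronVector hA
  obtain ⟨k1, -, k3⟩ := isPerronVector_perronVector hA.transpose
  set r := perronVector A
  set l := perronVector A.transpose
  have e : l ⬝ᵥ A.mulVec r = A.transpose.mulVec l ⬝ᵥ r := by
    rw [Matrix.mulVec_transpose, Matrix.dotProduct_mulVec]
  rw [h3, k3, dotProduct_smul, smul_dotProduct, smul_eq_mul, smul_eq_mul] at e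
  have hpos : 0 < l ⬝ᵥ r :=
    Finset.sum_pos (fun x _ => mul_pos (k1 x) (h1 x)) Finset.univ_nonempty
  exact (mul_right_cancel₀ hpos.ne' e).symm

lemma perronRoot_pos [Nonempty X] {A : Matrix X X ℝ} (hA : A.IsIrreducible) :
    0 < perronRoot A := by
  obtain ⟨h1, -, h3⟩ := isPerronVector_perronVector hA
  refine lt_of_le_of_ne (eigenvalue_nonneg hA.nonneg h1 h3) fun h0 => ?_
  obtain ⟨x⟩ := ‹Nonempty X›
  obtain ⟨k, hk, hkx⟩ := (Matrix.isIrreducible_iff_exists_pow_pos hA.nonneg).1 hA x x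
  have h4 := congrFun (pow_mulVec_of_eigen h3 k) x
  rw [← h0, zero_pow hk.ne', zero_smul] at h4
  have h5 : (A ^ k) x x * perronVector A x ≤ (A ^ k).mulVec (perronVector A) x :=
    Finset.single_le_sum (f := fun z => (A ^ k) x z * perronVector A z)
      (fun z _ => mul_nonneg (Matrix.pow_apply_nonneg hA.nonneg k x z) (h1 z).le)
      (Finset.mem_univ x)
  rw [h4] at h5
  exact absurd h5 (not_le.2 (mul_pos hkx (h1 x)))

/-- The normalization of the eigenvector eliminates the eigenvalue, leaving an equation in the
vector alone for the implicit function theorem. -/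
lemma perronRoot_eq_sum [Nonempty X] {A : Matrix X X ℝ} (hA : A.IsIrreducible) :
    perronRoot A = ∑ x, A.mulVec (perronVector A) x := by
  obtain ⟨-, h2, h3⟩ := isPerronVector_perronVector hA
  rw [h3]
  simp [← Finset.mul_sum, h2]

/-! ### Smooth dependence of the Perron vector and root -/

/-- Its zeros of nonzero eigenvalue are the eigenvectors of `A` with entries summing to one. -/
def eigenDefect (A : ℝ → Matrix X X ℝ) (p : ℝ × (X → ℝ)) : X → ℝ :=
  (A p.1).mulVec p.2 - (∑ x, (A p.1).mulVec p.2 x) • p.2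

omit [DecidableEq X] in
lemma contDiff_eigenDefect {A : ℝ → Matrix X X ℝ} {n : WithTop ℕ∞}
    (hA : ∀ x y, ContDiff ℝ n fun t => A t x y) : ContDiff ℝ n (eigenDefect A) := by
  have h : ∀ x, ContDiff ℝ n fun p : ℝ × (X → ℝ) => (A p.1).mulVec p.2 x := fun x => by
    simp only [Matrix.mulVec, dotProduct]
    exact ContDiff.sum fun y _ => ((hA x y).comp contDiff_fst).mul (by fun_prop)
  rw [contDiff_pi]
  intro x
  simp only [eigenDefect, Pi.sub_apply, Pi.smul_apply, smul_eq_mul]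
  exact (h x).sub ((ContDiff.sum fun y _ => h y).mul (by fun_prop))

omit [DecidableEq X] in
lemma fderiv_eigenDefect {A : ℝ → Matrix X X ℝ} {t : ℝ} {u : X → ℝ}
    (hd : DifferentiableAt ℝ (eigenDefect A) (t, u)) (w : X → ℝ) :
    fderiv ℝ (eigenDefect A) (t, u) (0, w) = (A t).mulVec w -
      (∑ x, (A t).mulVec w x) • u - (∑ x, (A t).mulVec u x) • w := by
  have h1 : HasDerivAt (fun s : ℝ => (t, u + s • w)) ((0 : ℝ), w) 0 := by
    have := (((hasDerivAt_id (0 : ℝ)).smul_const w).const_add u)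
    simpa using (hasDerivAt_const (0 : ℝ) t).prodMk this
  have h2 : HasDerivAt (fun s : ℝ => eigenDefect A (t, u + s • w))
      (fderiv ℝ (eigenDefect A) (t, u) (0, w)) 0 := by
    refine HasFDerivAt.comp_hasDerivAt (0 : ℝ) (l := eigenDefect A) ?_ h1
    simpa using hd.hasFDerivAt
  refine h2.unique ?_
  rw [hasDerivAt_pi]
  intro x
  have h3 : (fun s : ℝ => eigenDefect A (t, u + s • w) x) = fun s : ℝ =>
      (A t).mulVec u x + s * (A t).mulVec w x -
        (∑ y, (A t).mulVec u y + s * ∑ y, (A t).mulVec w y) * (u x + s * w x) := by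
    funext s
    simp [eigenDefect, Matrix.mulVec_add, Matrix.mulVec_smul, Finset.sum_add_distrib,
      ← Finset.mul_sum]
    ring
  rw [h3]
  have hid := hasDerivAt_id (0 : ℝ)
  have := ((hid.mul_const ((A t).mulVec w x)).const_add ((A t).mulVec u x)).sub
    (((hid.mul_const (∑ y, (A t).mulVec w y)).const_add (∑ y, (A t).mulVec u y)).mul
      ((hid.mul_const (w x)).const_add (u x)))
  refine this.congr_deriv ?_
  simp only [Pi.sub_apply, Pi.smul_apply, smul_eq_mul, id]
  ring

/-- In finite dimension injectivity suffices. Pairing a kernel vector `w` with the left Perron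
vector leaves `∑ Aw = 0`; so `w` is an eigenvector for the Perron root with entries summing to zero,
and simplicity of the root gives `w = 0`. -/
lemma isInvertible_fderiv_eigenDefect [Nonempty X] {A : ℝ → Matrix X X ℝ} {t : ℝ}
    (hA : (A t).IsIrreducible)
    (hd : DifferentiableAt ℝ (eigenDefect A) (t, perronVector (A t))) :
    (fderiv ℝ (eigenDefect A) (t, perronVector (A t)) ∘L .inr ℝ ℝ (X → ℝ)).IsInvertible := by
  set u := perronVector (A t) with hu
  set T := fderiv ℝ (eigenDefect A) (t, u) ∘L .inr ℝ ℝ (X → ℝ) with hT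
  have hTw : ∀ w, T w = (A t).mulVec w - (∑ x, (A t).mulVec w x) • u - perronRoot (A t) • w := by
    intro w
    rw [perronRoot_eq_sum hA, ← fderiv_eigenDefect hd w]
    rfl
  obtain ⟨h1, h2, h3⟩ := isPerronVector_perronVector hA
  obtain ⟨k1, -, k3⟩ := isPerronVector_perronVector hA.transpose
  rw [← hu] at h1 h2 h3
  set l := perronVector (A t).transpose
  have hinj : Function.Injective T := by
    rw [injective_iff_map_eq_zero]
    intro w hw
    rw [hTw] at hw
    have hlu : 0 < l ⬝ᵥ u :=
      Finset.sum_pos (fun x _ => mul_pos (k1 x) (h1 x)) Finset.univ_nonempty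
    have e1 : l ⬝ᵥ (A t).mulVec w = perronRoot (A t) * (l ⬝ᵥ w) := by
      rw [Matrix.dotProduct_mulVec, ← Matrix.mulVec_transpose, k3, smul_dotProduct,
        perronRoot_transpose hA, smul_eq_mul]
    have e2 := congrArg (fun z => l ⬝ᵥ z) hw
    simp only [dotProduct_sub, dotProduct_smul, dotProduct_zero, e1, smul_eq_mul] at e2
    have hs : ∑ x, (A t).mulVec w x = 0 := by
      have : (∑ x, (A t).mulVec w x) * (l ⬝ᵥ u) = 0 := by linarith
      exact (mul_eq_zero.1 this).resolve_right hlu.ne'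
    rw [hs, zero_smul, sub_zero, sub_eq_zero] at hw
    have hsw : ∑ x, w x = 0 := by
      have : perronRoot (A t) * ∑ x, w x = 0 := by
        rw [← hs, hw, Finset.mul_sum]
        rfl
      exact (mul_eq_zero.1 this).resolve_left (perronRoot_pos hA).ne'
    -- `c` is the least constant making `w + c • u` nonnegative; the sum then vanishes at `x₀`,
    -- hence everywhere.
    obtain ⟨x₀, hx₀⟩ := Finite.exists_max fun x => -w x / u x
    set c := -w x₀ / u x₀ with hc
    have p1 : ∀ x, 0 ≤ (w + c • u) x := fun x => by
      have := (div_le_iff₀ (h1 x)).1 (hx₀ x)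
      simp only [Pi.add_apply, Pi.smul_apply, smul_eq_mul]
      linarith
    have p2 : (A t).mulVec (w + c • u) = perronRoot (A t) • (w + c • u) := by
      rw [Matrix.mulVec_add, Matrix.mulVec_smul, hw, h3, smul_add, smul_comm]
    have p3 : w + c • u = 0 := by
      by_contra hne
      have := eigenvector_pos hA p1 hne p2 x₀
      simp [hc, div_mul_cancel₀ _ (h1 x₀).ne'] at this
    have p4 : c = 0 := by
      have := congrArg (fun z : X → ℝ => ∑ x, z x) p3
      simpa [Finset.sum_add_distrib, ← Finset.mul_sum, h2, hsw] using this
    simpa [p4] using p3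
  exact ⟨(LinearEquiv.ofInjectiveEndo (T : (X → ℝ) →ₗ[ℝ] (X → ℝ)) hinj).toContinuousLinearEquiv,
    by ext; rfl⟩

/-- The Perron-Frobenius eigenvector depends smoothly on the entries of an irreducible matrix. -/
lemma contDiff_perronVector [Nonempty X] {A : ℝ → Matrix X X ℝ} {n : WithTop ℕ∞} (hn : n ≠ 0)
    (hA : ∀ x y, ContDiff ℝ n fun t => A t x y) (hirr : ∀ t, (A t).IsIrreducible) :
    ContDiff ℝ n fun t => perronVector (A t) := by
  rw [contDiff_iff_contDiffAt]
  intro t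
  have hc : ContDiffAt ℝ n (eigenDefect A) (t, perronVector (A t)) :=
    (contDiff_eigenDefect hA).contDiffAt
  have hinv := isInvertible_fderiv_eigenDefect (hirr t) (hc.differentiableAt hn)
  obtain ⟨h1, h2, h3⟩ := isPerronVector_perronVector (hirr t)
  set ψ := hc.implicitFunction hn hinv with hψ
  have hsm : ContDiffAt ℝ n ψ t := hc.contDiffAt_implicitFunction hn hinv
  have hψt : ψ t = perronVector (A t) := hc.implicitFunction_apply_self hn hinv
  -- Near `t` the implicit branch stays positive, so uniqueness of the normalized positive
  -- eigenvector identifies it with `perronVector`.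
  refine hsm.congr_of_eventuallyEq ?_
  have hzero : eigenDefect A (t, perronVector (A t)) = 0 := by
    simp only [eigenDefect]
    rw [← perronRoot_eq_sum (hirr t), h3, sub_self]
  have ev1 : ∀ᶠ s in 𝓝 t, eigenDefect A (s, ψ s) = 0 := by
    have := hc.eventually_apply_implicitFunction hn hinv
    simpa only [hzero] using this
  have ev2 : ∀ᶠ s in 𝓝 t, ∀ x, 0 < ψ s x := by
    rw [eventually_all]
    intro x
    have : ContinuousAt (fun s => ψ s x) t :=
      (continuous_apply x).continuousAt.comp hsm.continuousAt
    exact this.eventually (lt_mem_nhds (by simpa only [hψt] using h1 x))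
  filter_upwards [ev1, ev2] with s hs1 hs2
  have heig : (A s).mulVec (ψ s) = (∑ x, (A s).mulVec (ψ s) x) • ψ s := sub_eq_zero.1 hs1
  have hpos : 0 < ∑ x, (A s).mulVec (ψ s) x := by
    rw [← perronRoot_eq (hirr s).nonneg hs2 heig]
    exact perronRoot_pos (hirr s)
  have hsum : ∑ x, ψ s x = 1 := by
    have := congrArg (fun z : X → ℝ => ∑ x, z x) heig
    simp only [Pi.smul_apply, smul_eq_mul, ← Finset.mul_sum] at this
    exact (mul_eq_left₀ hpos.ne').1 this.symm
  exact perronVector_eq (hirr s) hs2 hsum heig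

lemma contDiff_perronRoot [Nonempty X] {A : ℝ → Matrix X X ℝ} {n : WithTop ℕ∞} (hn : n ≠ 0)
    (hA : ∀ x y, ContDiff ℝ n fun t => A t x y) (hirr : ∀ t, (A t).IsIrreducible) :
    ContDiff ℝ n fun t => perronRoot (A t) := by
  have hv := contDiff_pi.1 (contDiff_perronVector hn hA hirr)
  simp only [fun t => perronRoot_eq_sum (hirr t), Matrix.mulVec, dotProduct]
  exact ContDiff.sum fun x _ => ContDiff.sum fun y _ => (hA x y).mul (hv y)

end Perron

/-! ### The exponential family: score, information and convexity of the potential -/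

section Exponential

variable {X : Type*} [Fintype X] [DecidableEq X]

/-- Irreducibility depends only on which entries vanish, and tilting preserves these. -/
lemma pow_pos_of_support {A B : Matrix X X ℝ} (hA : ∀ x y, 0 ≤ A x y) (hB : ∀ x y, 0 ≤ B x y)
    (h : ∀ x y, 0 < A x y → 0 < B x y) (k : ℕ) (x y : X) (hk : 0 < (A ^ k) x y) :
    0 < (B ^ k) x y := by
  induction k generalizing y with
  | zero => simpa using hk
  | succ k ih =>
    rw [pow_succ, Matrix.mul_apply] at hk ⊢
    have hAk := Matrix.pow_apply_nonneg hA k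
    have hBk := Matrix.pow_apply_nonneg hB k
    rw [Finset.sum_pos_iff_of_nonneg fun z _ => mul_nonneg (hAk x z) (hA z y)] at hk
    obtain ⟨z, -, hz⟩ := hk
    rw [Finset.sum_pos_iff_of_nonneg fun z _ => mul_nonneg (hBk x z) (hB z y)]
    exact ⟨z, Finset.mem_univ z, mul_pos (ih z (pos_of_mul_pos_left hz (hA z y)))
      (h z y (pos_of_mul_pos_right hz (hAk x z)))⟩

lemma tilted_isIrreducible {W : Matrix X X ℝ} (hW : W.IsIrreducible) (g : X → X → ℝ) (s : ℝ) :
    (tilted W g s).IsIrreducible := by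
  have hB : ∀ x y, 0 ≤ tilted W g s x y := fun x y =>
    mul_nonneg (hW.nonneg x y) (Real.exp_pos _).le
  rw [Matrix.isIrreducible_iff_exists_pow_pos hB]
  intro x y
  obtain ⟨k, hk, hxy⟩ := (Matrix.isIrreducible_iff_exists_pow_pos hW.nonneg).1 hW x y
  exact ⟨k, hk, pow_pos_of_support hW.nonneg hB
    (fun x y h => mul_pos h (Real.exp_pos _)) k x y hxy⟩

omit [Fintype X] [DecidableEq X] in
lemma contDiff_tilted {n : WithTop ℕ∞} (W : Matrix X X ℝ) (g : X → X → ℝ) (x y : X) :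
    ContDiff ℝ n fun s => tilted W g s x y := by
  simp only [tilted, Matrix.of_apply]
  exact contDiff_const.mul (Real.contDiff_exp.comp (contDiff_id.mul contDiff_const))

/-- The logarithm of the Perron-Frobenius eigenvector of the transposed tilted matrix. -/
def logLeft (W : Matrix X X ℝ) (g : X → X → ℝ) (s : ℝ) (x : X) : ℝ :=
  Real.log (perronVector (tilted W g s).transpose x)

/-- The first derivative of `logLeft` in the parameter. -/
def logLeftDeriv (W : Matrix X X ℝ) (g : X → X → ℝ) (s : ℝ) (x : X) : ℝ :=
  deriv (fun s => logLeft W g s x) s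

/-- The second derivative of `logLeft` in the parameter. -/
def logLeftDeriv₂ (W : Matrix X X ℝ) (g : X → X → ℝ) (s : ℝ) (x : X) : ℝ :=
  deriv (fun s => logLeftDeriv W g s x) s

lemma hasDerivAt_of_contDiff_two {f : ℝ → ℝ} (hf : ContDiff ℝ 2 f) (s : ℝ) :
    HasDerivAt f (deriv f s) s ∧ HasDerivAt (deriv f) (deriv (deriv f) s) s :=
  ⟨(hf.differentiable (by norm_num) s).hasDerivAt,
    ((ContDiff.deriv' (n := 1) hf).differentiable (by norm_num) s).hasDerivAt⟩

lemma perronVector_transpose_pos [Nonempty X] {W : Matrix X X ℝ} (hW : W.IsIrreducible)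
    (g : X → X → ℝ) (s : ℝ) (x : X) : 0 < perronVector (tilted W g s).transpose x :=
  (isPerronVector_perronVector (tilted_isIrreducible hW g s).transpose).1 x

lemma contDiff_logLeft [Nonempty X] {W : Matrix X X ℝ} (hW : W.IsIrreducible)
    (g : X → X → ℝ) (x : X) : ContDiff ℝ 2 fun s => logLeft W g s x := by
  refine ContDiff.log (contDiff_pi.1 (contDiff_perronVector (by norm_num)
    (fun x y => ?_) fun s => (tilted_isIrreducible hW g s).transpose) x)
    fun s => (perronVector_transpose_pos hW g s x).ne'
  exact contDiff_tilted W g y x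

lemma contDiff_potential [Nonempty X] {W : Matrix X X ℝ} (hW : W.IsIrreducible)
    (g : X → X → ℝ) : ContDiff ℝ 2 (potential W g) :=
  ContDiff.log (contDiff_perronRoot (by norm_num) (contDiff_tilted W g)
    (tilted_isIrreducible hW g)) fun s => (perronRoot_pos (tilted_isIrreducible hW g s)).ne'

lemma hasDerivAt_expectationParam [Nonempty X] {W : Matrix X X ℝ} (hW : W.IsIrreducible)
    (g : X → X → ℝ) (s : ℝ) :
    HasDerivAt (expectationParam W g) (iteratedDeriv 2 (potential W g) s) s := by
  rw [iteratedDeriv_succ, iteratedDeriv_one]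
  exact (hasDerivAt_of_contDiff_two (contDiff_potential hW g) s).2

lemma expFamily_apply [Nonempty X] {W : Matrix X X ℝ} (hW : W.IsIrreducible)
    (g : X → X → ℝ) (s : ℝ) (x y : X) :
    expFamily W g s x y = W x y *
      Real.exp (s * g x y - potential W g s + (logLeft W g s x - logLeft W g s y)) := by
  rw [Real.exp_add, Real.exp_sub, Real.exp_sub, potential, logLeft, logLeft,
    Real.exp_log (perronRoot_pos (tilted_isIrreducible hW g s)),
    Real.exp_log (perronVector_transpose_pos hW g s x),
    Real.exp_log (perronVector_transpose_pos hW g s y)]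
  simp only [expFamily, tilted, Matrix.of_apply]
  ring

lemma sum_expFamily [Nonempty X] {W : Matrix X X ℝ} (hW : W.IsIrreducible)
    (g : X → X → ℝ) (s : ℝ) (y : X) : ∑ x, expFamily W g s x y = 1 := by
  have hA := tilted_isIrreducible hW g s
  obtain ⟨h1, -, h3⟩ := isPerronVector_perronVector hA.transpose
  have h4 := congrFun h3 y
  simp only [Matrix.mulVec, dotProduct, Matrix.transpose_apply, Pi.smul_apply,
    smul_eq_mul, perronRoot_transpose hA] at h4
  have h5 : ∀ x, expFamily W g s x y = (perronRoot (tilted W g s))⁻¹ *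
      (perronVector (tilted W g s).transpose y)⁻¹ *
      (tilted W g s x y * perronVector (tilted W g s).transpose x) := fun x => by
    simp only [expFamily, Matrix.of_apply]
    ring
  simp only [h5, ← Finset.mul_sum]
  rw [h4]
  have := (perronRoot_pos hA).ne'
  have := (h1 y).ne'
  field_simp

lemma expFamily_nonneg [Nonempty X] {W : Matrix X X ℝ} (hW : W.IsIrreducible)
    (g : X → X → ℝ) (s : ℝ) (x y : X) : 0 ≤ expFamily W g s x y := by
  rw [expFamily_apply hW]
  exact mul_nonneg (hW.nonneg x y) (Real.exp_pos _).le

/-- A positive stationary measure of `W_θ`. -/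
lemma exists_stationary [Nonempty X] {W : Matrix X X ℝ} (hW : W.IsIrreducible)
    (g : X → X → ℝ) (s : ℝ) :
    ∃ π : X → ℝ, (∀ x, 0 < π x) ∧ ∀ x, ∑ y, expFamily W g s x y * π y = π x := by
  have hA := tilted_isIrreducible hW g s
  obtain ⟨h1, -, h3⟩ := isPerronVector_perronVector hA
  have hl := perronVector_transpose_pos hW g s
  -- The entrywise product of the left and right Perron vectors; no normalization is needed.
  refine ⟨fun x => perronVector (tilted W g s).transpose x * perronVector (tilted W g s) x,
    fun x => mul_pos (hl x) (h1 x), fun x => ?_⟩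
  have h4 := congrFun h3 x
  simp only [Matrix.mulVec, dotProduct, Pi.smul_apply, smul_eq_mul] at h4
  have h5 : ∀ y, expFamily W g s x y *
      (perronVector (tilted W g s).transpose y * perronVector (tilted W g s) y) =
      (perronRoot (tilted W g s))⁻¹ * perronVector (tilted W g s).transpose x *
      (tilted W g s x y * perronVector (tilted W g s) y) := fun y => by
    have := (hl y).ne'
    simp only [expFamily, Matrix.of_apply]
    field_simp
  simp only [h5, ← Finset.mul_sum]
  rw [h4]
  have := (perronRoot_pos hA).ne'
  field_simp

/-- The score and information identities for a finite family `c ω * exp (K s ω)` of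
probability mass functions. -/
lemma score_identities {Ω : Type*} [Fintype Ω] {c : Ω → ℝ} {K K₁ K₂ : ℝ → Ω → ℝ}
    (h₁ : ∀ s ω, HasDerivAt (fun s => K s ω) (K₁ s ω) s)
    (h₂ : ∀ s ω, HasDerivAt (fun s => K₁ s ω) (K₂ s ω) s)
    (hc : ∀ s, ∑ ω, c ω * Real.exp (K s ω) = 1) (s : ℝ) :
    ∑ ω, c ω * Real.exp (K s ω) * K₁ s ω = 0 ∧
      ∑ ω, c ω * Real.exp (K s ω) * (K₁ s ω ^ 2 + K₂ s ω) = 0 := by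
  have e1 : ∀ s, ∑ ω, c ω * Real.exp (K s ω) * K₁ s ω = 0 := fun s => by
    have hd : HasDerivAt (fun s => ∑ ω, c ω * Real.exp (K s ω))
        (∑ ω, c ω * (Real.exp (K s ω) * K₁ s ω)) s :=
      HasDerivAt.fun_sum fun ω _ => (h₁ s ω).exp.const_mul (c ω)
    -- The differentiated sum is the constant `1`.
    simp only [hc] at hd
    simpa only [mul_assoc] using hd.unique (hasDerivAt_const s (1 : ℝ))
  refine ⟨e1 s, ?_⟩
  have hd : HasDerivAt (fun s => ∑ ω, c ω * Real.exp (K s ω) * K₁ s ω)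
      (∑ ω, (c ω * (Real.exp (K s ω) * K₁ s ω) * K₁ s ω + c ω * Real.exp (K s ω) * K₂ s ω)) s :=
    HasDerivAt.fun_sum fun ω _ => ((h₁ s ω).exp.const_mul (c ω)).mul (h₂ s ω)
  simp only [e1] at hd
  rw [← hd.unique (hasDerivAt_const s (0 : ℝ))]
  exact Finset.sum_congr rfl fun ω _ => by ring

lemma hasDerivAt_logLeft [Nonempty X] {W : Matrix X X ℝ} (hW : W.IsIrreducible)
    (g : X → X → ℝ) (s : ℝ) (x : X) :
    HasDerivAt (fun s => logLeft W g s x) (logLeftDeriv W g s x) s :=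
  (hasDerivAt_of_contDiff_two (contDiff_logLeft hW g x) s).1

lemma hasDerivAt_logLeftDeriv [Nonempty X] {W : Matrix X X ℝ} (hW : W.IsIrreducible)
    (g : X → X → ℝ) (s : ℝ) (x : X) :
    HasDerivAt (fun s => logLeftDeriv W g s x) (logLeftDeriv₂ W g s x) s :=
  (hasDerivAt_of_contDiff_two (contDiff_logLeft hW g x) s).2

lemma hasDerivAt_potential [Nonempty X] {W : Matrix X X ℝ} (hW : W.IsIrreducible)
    (g : X → X → ℝ) (s : ℝ) : HasDerivAt (potential W g) (expectationParam W g s) s :=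
  (hasDerivAt_of_contDiff_two (contDiff_potential hW g) s).1

/-- The logarithmic density `s m - n φ(s) + log l(x) - log l(y)` and its derivatives. -/
lemma hasDerivAt_logDensity [Nonempty X] {W : Matrix X X ℝ} (hW : W.IsIrreducible)
    (g : X → X → ℝ) (m n s : ℝ) (x y : X) :
    HasDerivAt (fun s => s * m - n * potential W g s + (logLeft W g s x - logLeft W g s y))
      (m - n * expectationParam W g s + (logLeftDeriv W g s x - logLeftDeriv W g s y)) s ∧
    HasDerivAt (fun s => m - n * expectationParam W g s +
        (logLeftDeriv W g s x - logLeftDeriv W g s y))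
      (-(n * iteratedDeriv 2 (potential W g) s) +
        (logLeftDeriv₂ W g s x - logLeftDeriv₂ W g s y)) s := by
  constructor
  · have := (((hasDerivAt_id s).mul_const m).fun_sub
      ((hasDerivAt_potential hW g s).const_mul n)).fun_add
      ((hasDerivAt_logLeft hW g s x).fun_sub (hasDerivAt_logLeft hW g s y))
    simpa using this
  · have := (((hasDerivAt_expectationParam hW g s).const_mul n).const_sub m).fun_add
      ((hasDerivAt_logLeftDeriv hW g s x).fun_sub (hasDerivAt_logLeftDeriv hW g s y))
    simpa using this

/-- Each column of `W_s` is a probability law with score `d`, to which the information identity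
applies. -/
lemma potential_iteratedDeriv_pos [Nonempty X] {W : Matrix X X ℝ} (hW : W.IsIrreducible)
    {g : X → X → ℝ} (hg : IsGenerator W g) (s : ℝ) :
    0 < iteratedDeriv 2 (potential W g) s := by
  by_contra! hle
  set d : X → X → ℝ := fun x y => g x y - expectationParam W g s +
    (logLeftDeriv W g s x - logLeftDeriv W g s y) with hd
  set b := logLeftDeriv₂ W g s with hb
  set q := iteratedDeriv 2 (potential W g) s with hq
  obtain ⟨π, hπ, hst⟩ := exists_stationary hW g s
  have hcol : ∀ y, ∑ x, expFamily W g s x y * (d x y ^ 2 + (-q + (b x - b y))) = 0 := by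
    intro y
    have h := (score_identities (c := fun x => W x y)
      (fun s x => (hasDerivAt_logDensity hW g (g x y) 1 s x y).1)
      (fun s x => (hasDerivAt_logDensity hW g (g x y) 1 s x y).2) (fun s => by
        simpa only [expFamily_apply hW, one_mul] using sum_expFamily hW g s y) s).2
    simpa only [expFamily_apply hW, one_mul] using h
  -- Stationarity of `π` makes the two `b` terms cancel.
  have hsum : ∑ y, ∑ x, π y * (expFamily W g s x y * d x y ^ 2) = q * ∑ y, π y := by
    have e0 : ∀ y, ∑ x, π y * (expFamily W g s x y * d x y ^ 2) =
        q * π y + b y * π y - ∑ x, b x * (expFamily W g s x y * π y) := by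
      intro y
      have e1 := hcol y
      have e2 : ∀ x, π y * (expFamily W g s x y * d x y ^ 2) =
          π y * (expFamily W g s x y * (d x y ^ 2 + (-q + (b x - b y)))) +
          (q + b y) * π y * expFamily W g s x y - b x * (expFamily W g s x y * π y) :=
        fun x => by ring
      simp only [e2, Finset.sum_sub_distrib, Finset.sum_add_distrib, ← Finset.mul_sum, e1,
        sum_expFamily hW]
      ring
    simp only [e0, Finset.sum_sub_distrib, Finset.sum_add_distrib]
    rw [Finset.sum_comm]
    simp only [← Finset.mul_sum, hst]
    ring
  have hnn : ∀ y x, 0 ≤ π y * (expFamily W g s x y * d x y ^ 2) := fun y x =>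
    mul_nonneg (hπ y).le (mul_nonneg (expFamily_nonneg hW g s x y) (sq_nonneg _))
  have h0 : ∑ y, ∑ x, π y * (expFamily W g s x y * d x y ^ 2) = 0 := by
    apply le_antisymm
    · rw [hsum]
      exact mul_nonpos_of_nonpos_of_nonneg hle (Finset.sum_nonneg fun y _ => (hπ y).le)
    · exact Finset.sum_nonneg fun y _ => Finset.sum_nonneg fun x _ => hnn y x
  -- Vanishing of `d` on the support of `W` is exactly the excluded form of `g`.
  refine hg ⟨fun x => -logLeftDeriv W g s x, expectationParam W g s, fun x y hxy => ?_⟩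
  have h1 := (Finset.sum_eq_zero_iff_of_nonneg fun y _ =>
    Finset.sum_nonneg fun x _ => hnn y x).1 h0 y (Finset.mem_univ y)
  have h2 := (Finset.sum_eq_zero_iff_of_nonneg fun x _ => hnn y x).1 h1 x (Finset.mem_univ x)
  have h3 : 0 < expFamily W g s x y := by
    rw [expFamily_apply hW]
    exact mul_pos hxy (Real.exp_pos _)
  have h4 : d x y = 0 := by
    simpa [(hπ y).ne', h3.ne'] using h2
  simp only [hd] at h4
  linarith

omit [DecidableEq X] in
lemma sum_pathLaw {V : Matrix X X ℝ} (hV : ∀ y, ∑ x, V x y = 1) (P : X → ℝ) (n : ℕ) :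
    ∑ ω, pathLaw V P n ω = ∑ x, P x := by
  induction n with
  | zero =>
    rw [← (Equiv.funUnique (Fin 1) X).symm.sum_comp]
    simp [pathLaw]
  | succ n ih =>
    -- The last state is split off, since its conditional law sums to one.
    rw [← (Fin.snocEquiv fun _ : Fin (n + 1 + 1) => X).sum_comp, Fintype.sum_prod_type_right, ← ih]
    refine Finset.sum_congr rfl fun ω _ => ?_
    have : ∀ x : X, pathLaw V P (n + 1) (Fin.snocEquiv (fun _ : Fin (n + 1 + 1) => X) (x, ω)) =
        pathLaw V P n ω * V x (ω (Fin.last n)) := by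
      intro x
      have h0 : (Fin.snoc ω x : Fin (n + 1 + 1) → X) 0 = ω 0 := by
        rw [← Fin.castSucc_zero, Fin.snoc_castSucc]
      simp only [pathLaw, Fin.snocEquiv_apply, Fin.prod_univ_castSucc, Fin.snoc_castSucc,
        Fin.succ_last, Fin.snoc_last, Fin.succ_castSucc, h0]
      ring
    simp only [this, ← Finset.mul_sum, hV, mul_one]

lemma sum_fin_telescope (n : ℕ) (f : Fin (n + 1) → ℝ) :
    ∑ i : Fin n, (f i.succ - f i.castSucc) = f (Fin.last n) - f 0 := by
  have h := (Fin.sum_univ_succ f).symm.trans (Fin.sum_univ_castSucc f)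
  rw [Finset.sum_sub_distrib]
  linarith

/-- The product of transition probabilities along a path. -/
def pathWeight (W : Matrix X X ℝ) (n : ℕ) (ω : Fin (n + 1) → X) : ℝ :=
  ∏ i : Fin n, W (ω i.succ) (ω i.castSucc)

/-- The logarithm of the density of the exponential family along a path. -/
def pathLogDensity (W : Matrix X X ℝ) (g : X → X → ℝ) (n : ℕ) (s : ℝ)
    (ω : Fin (n + 1) → X) : ℝ :=
  s * pathSum g n ω - n * potential W g s +
    (logLeft W g s (ω (Fin.last n)) - logLeft W g s (ω 0))

/-- The score along a path of the exponential family with fixed initial law. -/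
def pathScore (W : Matrix X X ℝ) (g : X → X → ℝ) (n : ℕ) (s : ℝ) (ω : Fin (n + 1) → X) : ℝ :=
  pathSum g n ω - n * expectationParam W g s +
    (logLeftDeriv W g s (ω (Fin.last n)) - logLeftDeriv W g s (ω 0))

lemma pathLaw_expFamily [Nonempty X] {W : Matrix X X ℝ} (hW : W.IsIrreducible)
    (g : X → X → ℝ) (P : X → ℝ) (n : ℕ) (s : ℝ) (ω : Fin (n + 1) → X) :
    pathLaw (expFamily W g s) P n ω =
      P (ω 0) * pathWeight W n ω * Real.exp (pathLogDensity W g n s ω) := by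
  simp only [pathLaw, expFamily_apply hW, Finset.prod_mul_distrib, ← Real.exp_sum,
    Finset.sum_add_distrib, sum_fin_telescope n fun i => logLeft W g s (ω i),
    Finset.sum_sub_distrib (f := fun i : Fin n => s * g (ω i.succ) (ω i.castSucc)),
    ← Finset.mul_sum, Finset.sum_const, Finset.card_univ, Fintype.card_fin, nsmul_eq_mul]
  rw [pathLogDensity, pathSum, pathWeight, mul_assoc]

/-- The score has mean zero, and its second moment is `n φ''` up to boundary terms. -/
lemma expect_pathScore [Nonempty X] {W : Matrix X X ℝ} (hW : W.IsIrreducible)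
    (g : X → X → ℝ) {P : X → ℝ} (hP : ∑ x, P x = 1) (n : ℕ) (s : ℝ) :
    expect (pathLaw (expFamily W g s) P n) (pathScore W g n s) = 0 ∧
    expect (pathLaw (expFamily W g s) P n) (fun ω => pathScore W g n s ω ^ 2) =
      n * iteratedDeriv 2 (potential W g) s -
        expect (pathLaw (expFamily W g s) P n) fun ω =>
          logLeftDeriv₂ W g s (ω (Fin.last n)) - logLeftDeriv₂ W g s (ω 0) := by
  have hone : ∀ s, ∑ ω, pathLaw (expFamily W g s) P n ω = 1 := fun s => by
    rw [sum_pathLaw (sum_expFamily hW g s), hP]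
  have h := score_identities (c := fun ω : Fin (n + 1) → X => P (ω 0) * pathWeight W n ω)
    (fun s ω => (hasDerivAt_logDensity hW g (pathSum g n ω) n s (ω (Fin.last n)) (ω 0)).1)
    (fun s ω => (hasDerivAt_logDensity hW g (pathSum g n ω) n s (ω (Fin.last n)) (ω 0)).2)
    (fun s => by
      rw [← hone s]
      simp only [pathLaw_expFamily hW]
      rfl) s
  have hp : ∀ ω, P (ω 0) * pathWeight W n ω * Real.exp (s * pathSum g n ω -
      n * potential W g s + (logLeft W g s (ω (Fin.last n)) - logLeft W g s (ω 0))) =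
      pathLaw (expFamily W g s) P n ω := fun ω => (pathLaw_expFamily hW g P n s ω).symm
  simp only [hp] at h
  refine ⟨h.1, ?_⟩
  have hn : n * iteratedDeriv 2 (potential W g) s = ∑ ω, pathLaw (expFamily W g s) P n ω *
      (n * iteratedDeriv 2 (potential W g) s) := by
    rw [← Finset.sum_mul, hone, one_mul]
  rw [eq_sub_iff_add_eq, ← sub_eq_zero, hn, ← h.2]
  simp only [expect, ← Finset.sum_add_distrib, ← Finset.sum_sub_distrib]
  exact Finset.sum_congr rfl fun ω _ => by rw [pathScore]; ring

end Exponential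

/-! ### Second moments under bounded perturbations -/

section Moments

variable {Ω : Type*} [Fintype Ω] {p : Ω → ℝ}

lemma expect_add (f g : Ω → ℝ) :
    expect p (fun ω => f ω + g ω) = expect p f + expect p g := by
  simp only [expect, mul_add, Finset.sum_add_distrib]

lemma expect_mul_const (f : Ω → ℝ) (c : ℝ) :
    expect p (fun ω => f ω * c) = expect p f * c := by
  simp only [expect, ← mul_assoc, Finset.sum_mul]

lemma expect_const (hp : ∑ ω, p ω = 1) (c : ℝ) : expect p (fun _ => c) = c := by
  rw [expect, ← Finset.sum_mul, hp, one_mul]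

lemma expect_nonneg (h0 : ∀ ω, 0 ≤ p ω) {f : Ω → ℝ} (hf : ∀ ω, 0 ≤ f ω) : 0 ≤ expect p f :=
  Finset.sum_nonneg fun ω _ => mul_nonneg (h0 ω) (hf ω)

lemma abs_expect_le (h0 : ∀ ω, 0 ≤ p ω) (hp : ∑ ω, p ω = 1) {f : Ω → ℝ} {C : ℝ}
    (hf : ∀ ω, |f ω| ≤ C) : |expect p f| ≤ C := by
  calc |expect p f| ≤ ∑ ω, |p ω * f ω| := Finset.abs_sum_le_sum_abs _ _
    _ ≤ ∑ ω, p ω * C := Finset.sum_le_sum fun ω _ => by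
        rw [abs_mul, abs_of_nonneg (h0 ω)]
        exact mul_le_mul_of_nonneg_left (hf ω) (h0 ω)
    _ = C := by rw [← Finset.sum_mul, hp, one_mul]

lemma expect_mul_sq_le (h0 : ∀ ω, 0 ≤ p ω) (f g : Ω → ℝ) :
    expect p (fun ω => f ω * g ω) ^ 2 ≤
      expect p (fun ω => f ω ^ 2) * expect p fun ω => g ω ^ 2 :=
  Finset.sum_sq_le_sum_mul_sum_of_sq_le_mul _
    (fun ω _ => mul_nonneg (h0 ω) (sq_nonneg _)) (fun ω _ => mul_nonneg (h0 ω) (sq_nonneg _))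
    fun ω _ => le_of_eq (by ring)

/-- Cauchy-Schwarz on the cross term: the error is of the order of the square root of the second
moment of `Y`. -/
lemma abs_expect_add_sq_sub_le (h0 : ∀ ω, 0 ≤ p ω) (hp : ∑ ω, p ω = 1) (Y : Ω → ℝ)
    {R : Ω → ℝ} {C : ℝ} (hR : ∀ ω, |R ω| ≤ C) :
    |expect p (fun ω => (Y ω + R ω) ^ 2) - expect p fun ω => Y ω ^ 2| ≤
      2 * √(expect p (fun ω => Y ω ^ 2) * C ^ 2) + C ^ 2 := by
  have e : expect p (fun ω => (Y ω + R ω) ^ 2) = expect p (fun ω => Y ω ^ 2) +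
      expect p (fun ω => Y ω * R ω) * 2 + expect p fun ω => R ω ^ 2 := by
    rw [← expect_mul_const, ← expect_add, ← expect_add]
    congr 1
    funext ω
    ring
  have hR2 : expect p (fun ω => R ω ^ 2) ≤ C ^ 2 := by
    refine (le_abs_self _).trans (abs_expect_le h0 hp fun ω => ?_)
    rw [abs_pow]
    exact pow_le_pow_left₀ (abs_nonneg _) (hR ω) 2
  have hY := expect_nonneg h0 fun ω => sq_nonneg (Y ω)
  have hYR : |expect p (fun ω => Y ω * R ω)| ≤ √(expect p (fun ω => Y ω ^ 2) * C ^ 2) :=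
    Real.abs_le_sqrt ((expect_mul_sq_le h0 Y R).trans (mul_le_mul_of_nonneg_left hR2 hY))
  have hR0 := expect_nonneg h0 fun ω => sq_nonneg (R ω)
  rw [abs_le] at hYR ⊢
  constructor <;> linarith [hYR.1, hYR.2]

end Moments

/-- A bounded perturbation does not change the growth rate of the second moment. -/
lemma tendsto_expect_add_sq {Ω : ℕ → Type*} [∀ n, Fintype (Ω n)] {p Y R : ∀ n, Ω n → ℝ}
    (h0 : ∀ n ω, 0 ≤ p n ω) (hp : ∀ n, ∑ ω, p n ω = 1) {C q : ℝ} (hR : ∀ n ω, |R n ω| ≤ C)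
    (hY : Tendsto (fun n : ℕ => expect (p n) (fun ω => Y n ω ^ 2) / n) atTop (𝓝 q)) :
    Tendsto (fun n : ℕ => expect (p n) (fun ω => (Y n ω + R n ω) ^ 2) / n) atTop (𝓝 q) := by
  have hC := tendsto_const_div_atTop_nhds_zero_nat (C ^ 2)
  -- After division by `n`, the root contains a convergent factor times `C ^ 2 / n`.
  have hb : Tendsto (fun n : ℕ => 2 * √(expect (p n) (fun ω => Y n ω ^ 2) / n * (C ^ 2 / n)) +
      C ^ 2 / n) atTop (𝓝 0) := by
    simpa using ((hY.mul hC).sqrt.const_mul 2).add hC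
  have hd : Tendsto (fun n : ℕ => expect (p n) (fun ω => (Y n ω + R n ω) ^ 2) / n -
      expect (p n) (fun ω => Y n ω ^ 2) / n) atTop (𝓝 0) := by
    refine squeeze_zero_norm (fun n => ?_) hb
    have hn : (0 : ℝ) ≤ n := Nat.cast_nonneg n
    rw [← sub_div, Real.norm_eq_abs, abs_div, abs_of_nonneg hn, div_mul_div_comm,
      Real.sqrt_div' _ (mul_nonneg hn hn), Real.sqrt_mul_self hn, ← mul_div_assoc, ← add_div]
    exact div_le_div_of_nonneg_right (abs_expect_add_sq_sub_le (h0 n) (hp n) (Y n) (hR n)) hn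
  simpa using hd.add hY

/-- Centring removes the constant `c`, here of order `n`, and leaves `Y` plus a bounded term as soon
as `R` is bounded. -/
lemma pvar_div_sqrt {Ω : Type*} [Fintype Ω] {p : Ω → ℝ} (hp : ∑ ω, p ω = 1)
    {f Y R : Ω → ℝ} {c : ℝ} (hf : ∀ ω, f ω = Y ω + R ω + c) (hY : expect p Y = 0) (n : ℕ) :
    pvar p (fun ω => f ω / √(n : ℝ)) =
      expect p (fun ω => (Y ω + (R ω - expect p R)) ^ 2) / n := by
  have e1 : expect p (fun ω => f ω / √(n : ℝ)) = (expect p R + c) / √(n : ℝ) := by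
    simp only [div_eq_mul_inv, expect_mul_const, hf, expect_add, hY, expect_const hp, zero_add]
  rw [pvar, e1, div_eq_mul_inv (expect p _) (n : ℝ), ← expect_mul_const]
  congr 1
  funext ω
  rw [← sub_div, div_pow, Real.sq_sqrt (Nat.cast_nonneg n), hf, div_eq_mul_inv]
  congr 2
  ring

/-! ### Asymptotics of the estimator -/

section Markov

variable {X : Type*} [Fintype X] [DecidableEq X]

omit [DecidableEq X] in
lemma exists_abs_le_of_finite (u : X → ℝ) : ∃ C, ∀ x, |u x| ≤ C :=
  ⟨∑ x, |u x|, fun x =>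
    Finset.single_le_sum (f := fun x => |u x|) (fun _ _ => abs_nonneg _) (Finset.mem_univ x)⟩

omit [DecidableEq X] in
lemma exists_abs_boundary_le (u v : X → ℝ) :
    ∃ C, ∀ (n : ℕ) (ω : Fin (n + 1) → X), |u (ω (Fin.last n)) + v (ω 0)| ≤ C := by
  obtain ⟨C, hC⟩ := exists_abs_le_of_finite u
  obtain ⟨D, hD⟩ := exists_abs_le_of_finite v
  exact ⟨C + D, fun n ω => (abs_add_le _ _).trans (add_le_add (hC _) (hD _))⟩

variable {W : Matrix X X ℝ} {g : X → X → ℝ} {P : ℝ → X → ℝ}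

lemma modelLaw_nonneg [Nonempty X] (hW : W.IsIrreducible) (hP0 : ∀ s x, 0 ≤ P s x) (n : ℕ)
    (s : ℝ) (ω : Fin (n + 1) → X) : 0 ≤ modelLaw W g P n s ω :=
  mul_nonneg (hP0 _ _) (Finset.prod_nonneg fun _ _ => expFamily_nonneg hW g s _ _)

lemma sum_modelLaw [Nonempty X] (hW : W.IsIrreducible) (hP1 : ∀ s, ∑ x, P s x = 1) (n : ℕ)
    (s : ℝ) : ∑ ω, modelLaw W g P n s ω = 1 := by
  rw [← hP1 s]
  exact sum_pathLaw (sum_expFamily hW g s) (P s) n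

lemma tendsto_expect_pathScore_sq [Nonempty X] (hW : W.IsIrreducible)
    (hP0 : ∀ s x, 0 ≤ P s x) (hP1 : ∀ s, ∑ x, P s x = 1) (s : ℝ) :
    Tendsto (fun n : ℕ => expect (modelLaw W g P n s) (fun ω => pathScore W g n s ω ^ 2) / n)
      atTop (𝓝 (iteratedDeriv 2 (potential W g) s)) := by
  set q := iteratedDeriv 2 (potential W g) s
  obtain ⟨C, hC⟩ := exists_abs_boundary_le (fun x => logLeftDeriv₂ W g s x)
    (fun x => -logLeftDeriv₂ W g s x)
  have hd : Tendsto (fun n : ℕ => expect (modelLaw W g P n s) (fun ω => logLeftDeriv₂ W g s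
      (ω (Fin.last n)) - logLeftDeriv₂ W g s (ω 0)) / n) atTop (𝓝 0) := by
    refine squeeze_zero_norm (fun n => ?_) (tendsto_const_div_atTop_nhds_zero_nat C)
    rw [Real.norm_eq_abs, abs_div, Nat.abs_cast]
    refine div_le_div_of_nonneg_right (abs_expect_le (modelLaw_nonneg hW hP0 n s)
      (sum_modelLaw hW hP1 n s) fun ω => ?_) (Nat.cast_nonneg n)
    rw [sub_eq_add_neg]
    exact hC n ω
  have h := (tendsto_const_nhds (x := q)).sub hd
  rw [sub_zero] at h
  refine h.congr' ?_
  filter_upwards [eventually_gt_atTop 0] with n hn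
  have hn' : (n : ℝ) ≠ 0 := by exact_mod_cast hn.ne'
  rw [modelLaw, (expect_pathScore hW g (hP1 s) n s).2, sub_div, mul_div_cancel_left₀ _ hn']

/-- The difference between the corrected sum and its asymptotic mean is the score up to a
bounded term. -/
def boundaryTerm (W : Matrix X X ℝ) (g : X → X → ℝ) (h : X → ℝ) (s : ℝ) (n : ℕ)
    (ω : Fin (n + 1) → X) : ℝ :=
  -logLeftDeriv W g s (ω (Fin.last n)) + (logLeftDeriv W g s (ω 0) + h (ω 0))

lemma correctedSum_eq (h : X → ℝ) (s : ℝ) (n : ℕ) (ω : Fin (n + 1) → X) :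
    correctedSum g h n ω =
      pathScore W g n s ω + boundaryTerm W g h s n ω + n * expectationParam W g s := by
  rw [correctedSum, pathScore, boundaryTerm]
  ring

lemma exists_abs_boundaryTerm_le (W : Matrix X X ℝ) (g : X → X → ℝ) (h : X → ℝ) (s : ℝ) :
    ∃ C, ∀ n ω, |boundaryTerm W g h s n ω| ≤ C :=
  exists_abs_boundary_le (fun x => -logLeftDeriv W g s x) fun x => logLeftDeriv W g s x + h x

lemma expect_modelLaw_pathScore [Nonempty X] (hW : W.IsIrreducible)
    (hP1 : ∀ s, ∑ x, P s x = 1) (n : ℕ) (s : ℝ) :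
    expect (modelLaw W g P n s) (pathScore W g n s) = 0 :=
  (expect_pathScore hW g (hP1 s) n s).1

lemma tendsto_expect_correctedSum [Nonempty X] (hW : W.IsIrreducible)
    (hP0 : ∀ s x, 0 ≤ P s x) (hP1 : ∀ s, ∑ x, P s x = 1) (h : X → ℝ) (s : ℝ) :
    Tendsto (fun n : ℕ => expect (modelLaw W g P n s) fun ω => correctedSum g h n ω / n) atTop
      (𝓝 (expectationParam W g s)) := by
  obtain ⟨C, hC⟩ := exists_abs_boundaryTerm_le W g h s
  have hd : Tendsto (fun n : ℕ => expect (modelLaw W g P n s) (boundaryTerm W g h s n) / n)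
      atTop (𝓝 0) := by
    refine squeeze_zero_norm (fun n => ?_) (tendsto_const_div_atTop_nhds_zero_nat C)
    rw [Real.norm_eq_abs, abs_div, Nat.abs_cast]
    exact div_le_div_of_nonneg_right (abs_expect_le (modelLaw_nonneg hW hP0 n s)
      (sum_modelLaw hW hP1 n s) (hC n)) (Nat.cast_nonneg n)
  have h2 := hd.add_const (expectationParam W g s)
  rw [zero_add] at h2
  refine h2.congr' ?_
  filter_upwards [eventually_gt_atTop 0] with n hn
  have hn' : (n : ℝ) ≠ 0 := by exact_mod_cast hn.ne'
  simp only [correctedSum_eq (W := W) h s, div_eq_mul_inv, expect_mul_const, expect_add,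
    expect_modelLaw_pathScore hW hP1, expect_const (sum_modelLaw hW hP1 n s)]
  field_simp
  ring

lemma tendsto_mul_mse [Nonempty X] (hW : W.IsIrreducible)
    (hP0 : ∀ s x, 0 ≤ P s x) (hP1 : ∀ s, ∑ x, P s x = 1) (h : X → ℝ) (s : ℝ) :
    Tendsto (fun n : ℕ => (n : ℝ) * mse W g P h n s) atTop
      (𝓝 (iteratedDeriv 2 (potential W g) s)) := by
  obtain ⟨C, hC⟩ := exists_abs_boundaryTerm_le W g h s
  refine (tendsto_expect_add_sq (fun n => modelLaw_nonneg hW hP0 n s)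
    (fun n => sum_modelLaw hW hP1 n s) hC
    (tendsto_expect_pathScore_sq hW hP0 hP1 s)).congr' ?_
  filter_upwards [eventually_gt_atTop 0] with n hn
  have hn' : (n : ℝ) ≠ 0 := by exact_mod_cast hn.ne'
  rw [mse, div_eq_mul_inv, mul_comm (n : ℝ), ← expect_mul_const, ← expect_mul_const]
  congr 1
  funext ω
  rw [correctedSum_eq (W := W) h s]
  field_simp
  ring

lemma tendsto_pvar_correctedSum [Nonempty X] (hW : W.IsIrreducible)
    (hP0 : ∀ s x, 0 ≤ P s x) (hP1 : ∀ s, ∑ x, P s x = 1) (h : X → ℝ) (s : ℝ) :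
    Tendsto (fun n : ℕ => pvar (modelLaw W g P n s) fun ω => correctedSum g h n ω / √(n : ℝ))
      atTop (𝓝 (iteratedDeriv 2 (potential W g) s)) := by
  obtain ⟨C, hC⟩ := exists_abs_boundaryTerm_le W g h s
  refine (tendsto_expect_add_sq (C := C + C) (fun n => modelLaw_nonneg hW hP0 n s)
    (fun n => sum_modelLaw hW hP1 n s)
    (R := fun n ω => boundaryTerm W g h s n ω -
      expect (modelLaw W g P n s) (boundaryTerm W g h s n)) (fun n ω => ?_)
    (tendsto_expect_pathScore_sq hW hP0 hP1 s)).congr fun n => ?_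
  · exact (abs_sub _ _).trans (add_le_add (hC n ω)
      (abs_expect_le (modelLaw_nonneg hW hP0 n s) (sum_modelLaw hW hP1 n s) (hC n)))
  · exact (pvar_div_sqrt (sum_modelLaw hW hP1 n s) (correctedSum_eq (W := W) h s n)
      (expect_modelLaw_pathScore hW hP1 n s) n).symm

/-! ### Fisher information in both parameters -/

/-- The logarithmic derivative of the initial law; it vanishes where the initial law does. -/
def initialScore (P : ℝ → X → ℝ) (s : ℝ) (x : X) : ℝ :=
  deriv (fun s => P s x) s / P s x

/-- The moving initial law adds to the score only a function of the first state, bounded in `n`. -/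
lemma hasDerivAt_log_modelLaw [Nonempty X] (hW : W.IsIrreducible)
    (hPs : ∀ x, ContDiff ℝ 1 fun s => P s x) {n : ℕ} {s : ℝ} {ω : Fin (n + 1) → X}
    (h : modelLaw W g P n s ω ≠ 0) :
    HasDerivAt (fun s => Real.log (modelLaw W g P n s ω))
      (pathScore W g n s ω + initialScore P s (ω 0)) s := by
  have hform : ∀ s, modelLaw W g P n s ω =
      P s (ω 0) * pathWeight W n ω * Real.exp (pathLogDensity W g n s ω) :=
    fun s => pathLaw_expFamily hW g (P s) n s ω
  have hPω : P s (ω 0) ≠ 0 := fun h0 => h (by rw [hform, h0, zero_mul, zero_mul])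
  have hw : pathWeight W n ω ≠ 0 := fun h0 => h (by rw [hform, h0, mul_zero, zero_mul])
  have hK : HasDerivAt (fun s => pathLogDensity W g n s ω) (pathScore W g n s ω) s :=
    (hasDerivAt_logDensity hW g _ _ s _ _).1
  have hPd := ((hPs (ω 0)).differentiable one_ne_zero s).hasDerivAt
  have hd := (hPd.mul_const (pathWeight W n ω)).mul hK.exp
  have hd' : HasDerivAt (fun s => modelLaw W g P n s ω) _ s :=
    hd.congr_of_eventuallyEq (Eventually.of_forall hform)
  refine (hd'.log h).congr_deriv ?_
  have := (Real.exp_pos (pathLogDensity W g n s ω)).ne'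
  rw [hform, initialScore]
  field_simp
  ring

lemma fisherNatural_eq [Nonempty X] (hW : W.IsIrreducible)
    (hPs : ∀ x, ContDiff ℝ 1 fun s => P s x) (n : ℕ) (s : ℝ) :
    fisherNatural W g P n s =
      expect (modelLaw W g P n s) fun ω => (pathScore W g n s ω + initialScore P s (ω 0)) ^ 2 := by
  refine Finset.sum_congr rfl fun ω _ => ?_
  by_cases h : modelLaw W g P n s ω = 0
  · simp [h]
  · simp only [(hasDerivAt_log_modelLaw hW hPs h).deriv]

lemma tendsto_fisherNatural [Nonempty X] (hW : W.IsIrreducible)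
    (hP0 : ∀ s x, 0 ≤ P s x) (hP1 : ∀ s, ∑ x, P s x = 1)
    (hPs : ∀ x, ContDiff ℝ 1 fun s => P s x) (s : ℝ) :
    Tendsto (fun n : ℕ => fisherNatural W g P n s / n) atTop
      (𝓝 (iteratedDeriv 2 (potential W g) s)) := by
  obtain ⟨C, hC⟩ := exists_abs_le_of_finite (initialScore P s)
  simp only [fisherNatural_eq hW hPs]
  exact tendsto_expect_add_sq (fun n => modelLaw_nonneg hW hP0 n s)
    (fun n => sum_modelLaw hW hP1 n s) (fun n ω => hC (ω 0))
    (tendsto_expect_pathScore_sq hW hP0 hP1 s)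

lemma naturalParam_expectationParam [Nonempty X] (hW : W.IsIrreducible)
    (hg : IsGenerator W g) (s : ℝ) : naturalParam W g (expectationParam W g s) = s := by
  have hmono : StrictMono (expectationParam W g) := strictMono_of_deriv_pos fun s => by
    rw [(hasDerivAt_expectationParam hW g s).deriv]
    exact potential_iteratedDeriv_pos hW hg s
  exact Function.leftInverse_invFun hmono.injective s

/-- `naturalParam` is meaningful only on the range of `η`; a left inverse of a strictly
differentiable function with nonzero derivative suffices. -/
lemma hasDerivAt_naturalParam [Nonempty X] (hW : W.IsIrreducible)
    (hg : IsGenerator W g) (s : ℝ) :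
    HasDerivAt (naturalParam W g) (iteratedDeriv 2 (potential W g) s)⁻¹
      (expectationParam W g s) := by
  have hcd : ContDiff ℝ 1 (expectationParam W g) :=
    ContDiff.deriv' (n := 1) (contDiff_potential hW g)
  have hst : HasStrictDerivAt (expectationParam W g) (iteratedDeriv 2 (potential W g) s) s :=
    hcd.contDiffAt.hasStrictDerivAt' (hasDerivAt_expectationParam hW g s) one_ne_zero
  exact (hst.to_local_left_inverse (potential_iteratedDeriv_pos hW hg s).ne'
    (Eventually.of_forall (naturalParam_expectationParam hW hg))).hasDerivAt

lemma fisherExpectation_eq [Nonempty X] (hW : W.IsIrreducible) (hg : IsGenerator W g)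
    (hPs : ∀ x, ContDiff ℝ 1 fun s => P s x) (n : ℕ) (s : ℝ) :
    fisherExpectation W g P n s =
      fisherNatural W g P n s * (iteratedDeriv 2 (potential W g) s)⁻¹ ^ 2 := by
  have hinv := naturalParam_expectationParam hW hg s
  rw [fisherNatural_eq hW hPs, ← expect_mul_const, fisherExpectation, fisherInfo, hinv]
  refine Finset.sum_congr rfl fun ω _ => ?_
  by_cases h : modelLaw W g P n s ω = 0
  · simp [h]
  · have hd := hasDerivAt_log_modelLaw hW hPs h
    -- The chain rule needs the base point written as the value of `naturalParam`.
    rw [← hinv] at hd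
    have hc := HasDerivAt.comp (expectationParam W g s) hd (hasDerivAt_naturalParam hW hg s)
    rw [hinv] at hc
    have := hc.deriv
    simp only [Function.comp_def] at this
    simp only [this, mul_pow]

lemma tendsto_fisherExpectation [Nonempty X] (hW : W.IsIrreducible) (hg : IsGenerator W g)
    (hP0 : ∀ s x, 0 ≤ P s x) (hP1 : ∀ s, ∑ x, P s x = 1)
    (hPs : ∀ x, ContDiff ℝ 1 fun s => P s x) (s : ℝ) :
    Tendsto (fun n : ℕ => fisherExpectation W g P n s / n) atTop
      (𝓝 (iteratedDeriv 2 (potential W g) s)⁻¹) := by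
  have h := (tendsto_fisherNatural (g := g) hW hP0 hP1 hPs s).mul_const
    ((iteratedDeriv 2 (potential W g) s)⁻¹ ^ 2)
  have hpos := (potential_iteratedDeriv_pos hW hg s).ne'
  have e : iteratedDeriv 2 (potential W g) s * (iteratedDeriv 2 (potential W g) s)⁻¹ ^ 2 =
      (iteratedDeriv 2 (potential W g) s)⁻¹ := by
    field_simp
  rw [e] at h
  refine h.congr fun n => ?_
  rw [fisherExpectation_eq hW hg hPs]
  ring

lemma tendsto_mul_inv_fisherExpectation [Nonempty X] (hW : W.IsIrreducible)
    (hg : IsGenerator W g) (hP0 : ∀ s x, 0 ≤ P s x) (hP1 : ∀ s, ∑ x, P s x = 1)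
    (hPs : ∀ x, ContDiff ℝ 1 fun s => P s x) (s : ℝ) :
    Tendsto (fun n : ℕ => (n : ℝ) * (fisherExpectation W g P n s)⁻¹) atTop
      (𝓝 (iteratedDeriv 2 (potential W g) s)) := by
  have h := (tendsto_fisherExpectation hW hg hP0 hP1 hPs s).inv₀
    (inv_ne_zero (potential_iteratedDeriv_pos hW hg s).ne')
  rw [inv_inv] at h
  exact h.congr fun n => by rw [inv_div, div_eq_mul_inv]

end Markov

lemma isLittleO_one_div_nat {f : ℕ → ℝ} (h : Tendsto (fun n : ℕ => (n : ℝ) * f n) atTop (𝓝 0)) :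
    f =o[atTop] fun n : ℕ => 1 / (n : ℝ) := by
  refine (isLittleO_iff_tendsto' ?_).2 (h.congr fun n => ?_)
  · filter_upwards [eventually_gt_atTop 0] with n hn h0
    have hn' : (n : ℝ) ≠ 0 := by exact_mod_cast hn.ne'
    exact absurd h0 (one_div_ne_zero hn')
  · rw [div_div_eq_mul_div, div_one, mul_comm]

end

end MarkovExp

theorem mainTheorem8 {X : Type*} [Fintype X] [DecidableEq X]
    (W : Matrix X X ℝ) (g : X → X → ℝ) (P : ℝ → X → ℝ) (h : X → ℝ)
    (hW : MarkovExp.IsTransitionMatrix W) (hWe : MarkovExp.IsErgodic W)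
    (hg : MarkovExp.IsGenerator W g)
    (hP0 : ∀ θ x, 0 ≤ P θ x) (hP1 : ∀ θ, ∑ x, P θ x = 1)
    (hPs : ∀ x, ContDiff ℝ 1 fun θ => P θ x) (θ : ℝ) :
    -- the potential is twice differentiable, with positive second derivative
    ContDiff ℝ 2 (MarkovExp.potential W g) ∧
    0 < iteratedDeriv 2 (MarkovExp.potential W g) θ ∧
    -- asymptotic unbiasedness
    Tendsto (fun n : ℕ => MarkovExp.expect (MarkovExp.modelLaw W g P n θ)
        fun ω => MarkovExp.correctedSum g h n ω / n) atTop
      (𝓝 (MarkovExp.expectationParam W g θ)) ∧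
    -- mean square error and variances
    Tendsto (fun n : ℕ => (n : ℝ) * MarkovExp.mse W g P h n θ) atTop
      (𝓝 (iteratedDeriv 2 (MarkovExp.potential W g) θ)) ∧
    Tendsto (fun n : ℕ => MarkovExp.pvar (MarkovExp.modelLaw W g P n θ)
        fun ω => MarkovExp.correctedSum g h n ω / √(n : ℝ)) atTop
      (𝓝 (iteratedDeriv 2 (MarkovExp.potential W g) θ)) ∧
    Tendsto (fun n : ℕ => MarkovExp.pvar (MarkovExp.modelLaw W g P n θ)
        fun ω => MarkovExp.pathSum g n ω / √(n : ℝ)) atTop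
      (𝓝 (iteratedDeriv 2 (MarkovExp.potential W g) θ)) ∧
    -- Fisher information for the natural and for the expectation parameter
    Tendsto (fun n : ℕ => MarkovExp.fisherNatural W g P n θ / n) atTop
      (𝓝 (iteratedDeriv 2 (MarkovExp.potential W g) θ)) ∧
    Tendsto (fun n : ℕ => MarkovExp.fisherExpectation W g P n θ / n) atTop
      (𝓝 (iteratedDeriv 2 (MarkovExp.potential W g) θ)⁻¹) ∧
    -- asymptotic efficiency: both the Cramér-Rao bound and the mean square error
    -- are `φ''(θ) / n + o(1 / n)`, so the bound is attained at order `1 / n`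
    (fun n : ℕ => (MarkovExp.fisherExpectation W g P n θ)⁻¹ -
        iteratedDeriv 2 (MarkovExp.potential W g) θ / n)
      =o[atTop] (fun n : ℕ => 1 / (n : ℝ)) ∧
    (fun n : ℕ => MarkovExp.mse W g P h n θ - (MarkovExp.fisherExpectation W g P n θ)⁻¹)
      =o[atTop] (fun n : ℕ => 1 / (n : ℝ)) := by
  have hW' := hWe.1
  have : Nonempty X := by
    by_contra hX
    rw [not_nonempty_iff] at hX
    simpa using hP1 θ
  have hmse := MarkovExp.tendsto_mul_mse (g := g) hW' hP0 hP1 h θ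
  have hfish := MarkovExp.tendsto_mul_inv_fisherExpectation hW' hg hP0 hP1 hPs θ
  refine ⟨MarkovExp.contDiff_potential hW' g, MarkovExp.potential_iteratedDeriv_pos hW' hg θ,
    MarkovExp.tendsto_expect_correctedSum hW' hP0 hP1 h θ, hmse,
    MarkovExp.tendsto_pvar_correctedSum hW' hP0 hP1 h θ, ?_,
    MarkovExp.tendsto_fisherNatural hW' hP0 hP1 hPs θ,
    MarkovExp.tendsto_fisherExpectation hW' hg hP0 hP1 hPs θ,
    MarkovExp.isLittleO_one_div_nat ?_, MarkovExp.isLittleO_one_div_nat ?_⟩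
  -- The uncorrected sum is the case of zero correction.
  · simpa [MarkovExp.correctedSum] using
      MarkovExp.tendsto_pvar_correctedSum (g := g) hW' hP0 hP1 (fun _ => 0) θ
  · have h1 := hfish.sub_const (iteratedDeriv 2 (MarkovExp.potential W g) θ)
    rw [sub_self] at h1
    refine h1.congr' ?_
    filter_upwards [eventually_gt_atTop 0] with n hn
    have hn' : (n : ℝ) ≠ 0 := by exact_mod_cast hn.ne'
    rw [mul_sub, mul_div_cancel₀ _ hn']
  · simpa only [mul_sub, sub_self] using hmse.sub hfish
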